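/- Let $\mathbb R^{1,1}=\{x+jy : x,y\in\mathbb R\}$, $j^2=1$, be the algebra of split complex numbers, with the Euclidean topology of $\mathbb R^2$, and put $$\partial^+_{1,1}=\frac12\Bigl(\frac{\partial}{\partial x}-j\frac{\partial}{\partial y}\Bigr),\qquad dZ=dx+j\,dy .$$ Let $U\subset\mathbb R^{1,1}$ be a bounded open set with piecewise smooth boundary: $\partial U$ is a finite union of smooth regular arcs, parametrized smoothly with nowhere vanishing velocity on compact intervals, which are disjoint and without self-intersections except that end points may coincide, and at each interior point of an arc there is a nonzero vector perpendicular (in the Euclidean sense) to the arc that points outside of $U$. Give $\partial U$ its canonical orientation: at an interior point $p$ of an arc, a tangent vector $\tau_p\neq0$ of $\partial U$ points in the positive direction if and only if, for a nonzero vector $n_p$ perpendicular to $T_p\partial U$ and pointing outside of $U$, the basis $\{n_p,\tau_p\}$ has the same orientation as $\{1,j\}$. Let $V$ be an open neighborhood of the closure $\overline U$ and let $F:V\to\mathbb R^{1,1}$ be a smooth function such that $\partial^+_{1,1}F=0$ on $V$. Then $$\int_{\partial U}F\,dZ=0 .$$ -/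

import Mathlib

open Set Filter Topology
open scoped ContDiff unitInterval

noncomputable section

/-- The algebra `ℝ^{1,1}` of split complex numbers `x + j y` with `j ^ 2 = 1`;
the coordinates of `Z` are `x = Z.re` and `y = Z.im`. -/
abbrev SplitComplex : Type := QuadraticAlgebra ℝ 1 0

namespace SplitComplex

/-- The unit `j`. -/
def j : SplitComplex := ⟨0, 1⟩

theorem j_mul_j : j * j = 1 := by
  ext <;> simp [j, QuadraticAlgebra.re_one, QuadraticAlgebra.im_one]

/-- The identification of the underlying plane `ℝ²` with the Euclidean plane. -/
def toEuclidean : SplitComplex →ₗ[ℝ] EuclideanSpace ℝ (Fin 2) where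
  toFun Z := !₂[Z.re, Z.im]
  map_add' Z W := by ext i; fin_cases i <;> simp
  map_smul' c Z := by ext i; fin_cases i <;> simp

theorem toEuclidean_injective : Function.Injective toEuclidean := by
  intro Z W h
  have h0 := congrArg (fun v => v 0) h
  have h1 := congrArg (fun v => v 1) h
  ext
  · simpa [toEuclidean] using h0
  · simpa [toEuclidean] using h1

/-- `ℝ^{1,1}` carries the Euclidean norm `‖x + j y‖ = √(x² + y²)` and its topology. -/
instance : NormedAddCommGroup SplitComplex :=
  NormedAddCommGroup.induced SplitComplex (EuclideanSpace ℝ (Fin 2)) toEuclidean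
    toEuclidean_injective

instance : NormedSpace ℝ SplitComplex :=
  NormedSpace.induced ℝ SplitComplex (EuclideanSpace ℝ (Fin 2)) toEuclidean

theorem norm_eq (Z : SplitComplex) : ‖Z‖ = √(Z.re ^ 2 + Z.im ^ 2) := by
  change ‖toEuclidean Z‖ = _
  simp [toEuclidean, EuclideanSpace.norm_eq]

instance : CompleteSpace SplitComplex := FiniteDimensional.complete ℝ SplitComplex

/-- The operator `∂⁺ = (1/2) (∂/∂x - j ∂/∂y)`. -/
def dPlus (F : SplitComplex → SplitComplex) (Z : SplitComplex) : SplitComplex :=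
  (1 / 2 : ℝ) • (lineDeriv ℝ F Z 1 - j * lineDeriv ℝ F Z j)

/-- The `ℝ^{1,1}`-valued one-form `dZ = dx + j dy`. -/
def dZ : SplitComplex →L[ℝ] SplitComplex :=
  LinearMap.toContinuousLinearMap
    ((QuadraticAlgebra.reₗ (1 : ℝ) 0).smulRight 1 + (QuadraticAlgebra.imₗ (1 : ℝ) 0).smulRight j)

/-- The one-form `F dZ`. -/
def formMulDZ (F : SplitComplex → SplitComplex) (Z : SplitComplex) :
    SplitComplex →L[ℝ] SplitComplex :=
  LinearMap.toContinuousLinearMap (LinearMap.mulLeft ℝ (F Z) ∘ₗ dZ.toLinearMap)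

/-- `n` is a nonzero vector, perpendicular to `τ` in the Euclidean plane, which points outside
of `U` at the point `p`. -/
structure IsOutwardNormal (U : Set SplitComplex) (p τ n : SplitComplex) : Prop where
  ne_zero : n ≠ 0
  perp : n.re * τ.re + n.im * τ.im = 0
  outside : ∀ᶠ s in 𝓝[>] (0 : ℝ), p + s • n ∉ U

/-- The pair `{n, τ}` is a basis with the same orientation as `{1, j}`. -/
def PositivelyOriented (n τ : SplitComplex) : Prop :=
  0 < n.re * τ.im - n.im * τ.re

/-- The canonical orientation of `∂U`: a tangent vector `τ` of `∂U` at a smooth point `p` points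
in the positive direction if `{n, τ}` is positively oriented for an outward normal `n`. -/
def IsPositiveDirection (U : Set SplitComplex) (p τ : SplitComplex) : Prop :=
  ∃ n, IsOutwardNormal U p τ n ∧ PositivelyOriented n τ

/-- The velocity of a path at time `t ∈ [0, 1]` (one-sided at the end points). -/
def velocity {p q : SplitComplex} (γ : Path p q) (t : ℝ) : SplitComplex :=
  derivWithin γ.extend I t

/-- A presentation of `∂U` as a piecewise smooth curve: `∂U` is the union of finitely many regular
smooth arcs (parametrized in any direction). The arcs may share end points, and an arc may be a loop
at its end point, but they do not meet otherwise. At every interior point of an arc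
there is a normal vector that points outside of `U`. -/
structure PiecewiseSmoothBoundary (U : Set SplitComplex) where
  /-- the number of arcs -/
  card : ℕ
  /-- the initial points of the arcs -/
  source : Fin card → SplitComplex
  /-- the final points of the arcs -/
  target : Fin card → SplitComplex
  /-- the arcs -/
  arc : ∀ i, Path (source i) (target i)
  smooth : ∀ i, ContDiffOn ℝ ∞ (arc i).extend I
  regular : ∀ i, ∀ t ∈ I, velocity (arc i) t ≠ 0
  iUnion_range : ⋃ i, range (arc i) = frontier U
  simple : ∀ i k, ∀ s t : I, (t : ℝ) ∈ Ioo (0 : ℝ) 1 → arc i t = arc k s → i = k ∧ t = s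
  exists_outward : ∀ i, ∀ t : I, (t : ℝ) ∈ Ioo (0 : ℝ) 1 →
    ∃ n, IsOutwardNormal U (arc i t) (velocity (arc i) t) n

namespace PiecewiseSmoothBoundary

variable {U : Set SplitComplex}

open Classical in
/-- The sign that compares the parametrization of the `i`-th arc with the canonical orientation
of `∂U`: it is `1` if the velocity points in the positive direction, and `-1` otherwise. -/
def orientationSign (B : PiecewiseSmoothBoundary U) (i : Fin B.card) : ℝ :=
  if ∀ t : I, (t : ℝ) ∈ Ioo (0 : ℝ) 1 →
    IsPositiveDirection U (B.arc i t) (velocity (B.arc i) t) then 1 else -1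

/-- The integral of `F dZ` over `∂U` with its canonical orientation. -/
def boundaryIntegral (B : PiecewiseSmoothBoundary U) (F : SplitComplex → SplitComplex) :
    SplitComplex :=
  ∑ i, B.orientationSign i • curveIntegral (formMulDZ F) (B.arc i)

end PiecewiseSmoothBoundary

end SplitComplex

end

/-! ### Jumps of step functions on the line -/

section StepFunctions

/-! For `ε = ±1` the functional `ξ = x + ε y` is a character of the algebra, and the two characters
separate points. Applying one to `∫ F dZ` gives the real integral of `a dξ`, where `a = ξ ∘ F`. The
equation `∂⁺F = 0` says that `a` is locally constant along the null lines `ξ = c`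
(`constAlongNull_nullForm_comp`).

Instead of Green's formula, the integral is sliced by these lines. The area formula
(`exists_integral_eq_setIntegral_mul_deriv`) rewrites the boundary integral as an integral over `c`
of the signed sum of `a` over the points where the line `ξ = c` meets `∂U`. By Sard
(`ae_isRegularValue`), for almost every `c` these points are finitely many transversal crossings.
Along such a line `a`, cut off by zero outside `U`, is a step function with bounded support. Its
jumps add up to zero (`sum_jumps_eq_zero`), and they are the terms of the signed sum up to a common
sign (`IsRegularValue.sum_crossings_eq_zero`).

The signs match because each arc has `U` on exactly one side, the same along the whole arc, and
`orientationSign` records which (`exists_sides`, `orientationSign_spec`). -/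

theorem eq_of_forall_eventually_eq {h : ℝ → ℝ} (hh : ∀ x, ∀ᶠ y in 𝓝 x, h y = h x) (x y : ℝ) :
    h x = h y :=
  ((IsLocallyConstant.iff_eventually_eq h).2 hh).apply_eq_of_preconnectedSpace x y

/-- Induction on the largest jump point `a`: freezing `h` at `L a` from `a` on removes that jump,
and beyond `a` the function is constantly `R a`. The values at the jump points play no role. -/
theorem eventually_atTop_eq_sum_jumps (S : Finset ℝ) (L R : ℝ → ℝ) :
    ∀ h : ℝ → ℝ, (∀ s ∈ S, ∀ᶠ x in 𝓝[<] s, h x = L s) → (∀ s ∈ S, ∀ᶠ x in 𝓝[>] s, h x = R s) →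
      (∀ x ∉ S, ∀ᶠ y in 𝓝 x, h y = h x) → (∀ᶠ x in atBot, h x = 0) →
      ∀ᶠ x in atTop, h x = ∑ s ∈ S, (R s - L s) := by
  classical
  induction S using Finset.induction_on_max with
  | empty =>
    intro h _ _ hc hb
    obtain ⟨b, hb⟩ := hb.exists
    refine Eventually.of_forall fun x => ?_
    rw [eq_of_forall_eventually_eq (fun x => hc x (by simp)) x b, hb]
    simp
  | insert a S ha ih =>
    intro h hL hR hc hb
    have haS : a ∉ S := fun h => lt_irrefl _ (ha a h)
    have hLa := hL a (by simp)
    have hRa := hR a (by simp)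
    have h1 := ih (fun x => if x < a then h x else L a) (by
        intro s hs
        filter_upwards [hL s (by simp [hs]), nhdsWithin_le_nhds (Iio_mem_nhds (ha s hs))]
          with x hx hxa
        simp only [mem_Iio] at hxa
        simp [hx, hxa]) (by
        intro s hs
        filter_upwards [hR s (by simp [hs]), nhdsWithin_le_nhds (Iio_mem_nhds (ha s hs))]
          with x hx hxa
        simp only [mem_Iio] at hxa
        simp [hx, hxa]) (by
        intro x hx
        rcases lt_trichotomy x a with hxa | rfl | hxa
        · filter_upwards [hc x (by simp [hx, hxa.ne]), Iio_mem_nhds hxa] with y hy hya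
          simp only [mem_Iio] at hya
          simp [hxa, hya, hy]
        · filter_upwards [eventually_nhdsWithin_iff.1 hLa] with y hy
          by_cases hyx : y < x
          · simp [hyx, hy hyx]
          · simp [hyx]
        · filter_upwards [Ioi_mem_nhds hxa] with y hy
          simp only [mem_Ioi] at hy
          simp [hy.le.not_gt, hxa.le.not_gt]) (by
        filter_upwards [hb, eventually_lt_atBot a] with x hx hxa
        simp [hx, hxa])
    obtain ⟨b, hb1, hb2⟩ := (h1.and (eventually_gt_atTop a)).exists
    simp only [hb2.le.not_gt, if_false] at hb1
    -- Overwriting `h` by `R a` up to `a` leaves no jump at all, so `h = R a` to the right of `a`.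
    have h2 : ∀ x, ∀ᶠ y in 𝓝 x,
        (if a < y then h y else R a) = (if a < x then h x else R a) := by
      intro x
      rcases lt_trichotomy x a with hxa | rfl | hxa
      · filter_upwards [Iio_mem_nhds hxa] with y hy
        simp only [mem_Iio] at hy
        simp [hy.le.not_gt, hxa.le.not_gt]
      · filter_upwards [eventually_nhdsWithin_iff.1 hRa] with y hy
        by_cases hyx : x < y
        · simp [hyx, hy hyx]
        · simp [hyx]
      · have hxS : x ∉ insert a S := by
          simp only [Finset.mem_insert, not_or]
          exact ⟨hxa.ne', fun hx => lt_asymm hxa (ha x hx)⟩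
        filter_upwards [hc x hxS, Ioi_mem_nhds hxa] with y hy hya
        simp only [mem_Ioi] at hya
        simp [hxa, hya, hy]
    filter_upwards [eventually_gt_atTop a] with x hx
    have h3 := eq_of_forall_eventually_eq h2 x a
    simp only [hx, if_true, lt_irrefl, if_false] at h3
    rw [Finset.sum_insert haS, ← hb1, h3]
    ring

/-- The jumps of a compactly supported step function add up to zero. -/
theorem sum_jumps_eq_zero {ι : Type*} (T : Finset ι) (pos L R : ι → ℝ) (hpos : InjOn pos T)
    (h : ℝ → ℝ) (hL : ∀ i ∈ T, ∀ᶠ x in 𝓝[<] pos i, h x = L i)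
    (hR : ∀ i ∈ T, ∀ᶠ x in 𝓝[>] pos i, h x = R i)
    (hc : ∀ x, (∀ i ∈ T, x ≠ pos i) → ∀ᶠ y in 𝓝 x, h y = h x)
    (hb : ∀ᶠ x in atBot, h x = 0) (ht : ∀ᶠ x in atTop, h x = 0) :
    ∑ i ∈ T, (R i - L i) = 0 := by
  classical
  rcases T.eq_empty_or_nonempty with rfl | ⟨i₀, -⟩
  · simp
  have : Nonempty ι := ⟨i₀⟩
  have hinv : ∀ i ∈ T, Function.invFunOn pos T (pos i) = i := fun i hi =>
    hpos.leftInvOn_invFunOn hi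
  have := eventually_atTop_eq_sum_jumps (T.image pos) (L ∘ Function.invFunOn pos T)
    (R ∘ Function.invFunOn pos T) h (by
      intro s hs
      obtain ⟨i, hi, rfl⟩ := Finset.mem_image.1 hs
      simpa [hinv i hi] using hL i hi) (by
      intro s hs
      obtain ⟨i, hi, rfl⟩ := Finset.mem_image.1 hs
      simpa [hinv i hi] using hR i hi) (by
      intro x hx
      exact hc x fun i hi hxi => hx (Finset.mem_image.2 ⟨i, hi, hxi.symm⟩)) hb
  obtain ⟨x, hx1, hx2⟩ := (this.and ht).exists
  rw [hx2, Finset.sum_image hpos] at hx1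
  rw [hx1]
  exact Finset.sum_congr rfl fun i hi => by simp [hinv i hi]

end StepFunctions

/-! ### Area formula and Sard's theorem in one variable -/

section AreaFormula

open MeasureTheory

/-- An open set on which a function has nonzero continuous derivative decomposes into countably
many measurable pieces on which the function is injective. -/
theorem exists_measurable_partition_injOn {D : Set ℝ} (hD : IsOpen D) {ξ ξ' : ℝ → ℝ}
    (hξ : ∀ t ∈ D, HasStrictDerivAt ξ (ξ' t) t) (hξ' : ∀ t ∈ D, ξ' t ≠ 0) :
    ∃ A : ℕ → Set ℝ, (∀ n, MeasurableSet (A n)) ∧ Pairwise (Function.onFun Disjoint A) ∧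
      ⋃ n, A n = D ∧ ∀ n, InjOn ξ (A n) := by
  have hloc : ∀ t, ∃ W : Set ℝ, t ∈ D → IsOpen W ∧ t ∈ W ∧ W ⊆ D ∧ InjOn ξ W := by
    intro t
    by_cases ht : t ∈ D
    · have hs := (hξ t ht).hasStrictFDerivAt_equiv (hξ' t ht)
      let e := hs.toOpenPartialHomeomorph ξ
      refine ⟨e.source ∩ D, fun _ => ⟨e.open_source.inter hD,
        ⟨hs.mem_toOpenPartialHomeomorph_source, ht⟩, inter_subset_right, ?_⟩⟩
      exact fun x hx y hy hxy => e.injOn hx.1 hy.1 hxy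
    · exact ⟨∅, fun h => absurd h ht⟩
  choose W hW using hloc
  -- Lindelöf: countably many neighbourhoods of injectivity cover `D`; they are then made disjoint.
  obtain ⟨S, hSD, hSc, hDS⟩ := TopologicalSpace.countable_cover_nhdsWithin (f := W) (s := D)
    fun t ht => mem_nhdsWithin_of_mem_nhds ((hW t ht).1.mem_nhds (hW t ht).2.1)
  rcases S.eq_empty_or_nonempty with rfl | hSn
  · refine ⟨fun _ => ∅, fun _ => MeasurableSet.empty, fun _ _ _ => by simp [Function.onFun], ?_,
      fun _ => by simp⟩
    symm
    simpa using hDS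
  obtain ⟨f, rfl⟩ := hSc.exists_eq_range hSn
  have hf : ∀ n, f n ∈ D := fun n => hSD ⟨n, rfl⟩
  refine ⟨disjointed fun n => W (f n), fun n => ?_, disjoint_disjointed _, ?_, fun n => ?_⟩
  · exact MeasurableSet.disjointed (fun n => (hW _ (hf n)).1.measurableSet) n
  · rw [iUnion_disjointed]
    apply Subset.antisymm
    · exact iUnion_subset fun n => (hW _ (hf n)).2.2.1
    · simpa using hDS
  · exact (hW _ (hf n)).2.2.2.mono (disjointed_subset _ n)

theorem integrable_tsum_of_summable_integral_norm {g : ℕ → ℝ → ℝ} (hg : ∀ n, Integrable (g n))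
    (hsum : Summable fun n => ∫ c, ‖g n c‖) : Integrable fun c => ∑' n, g n c := by
  refine ⟨(AEMeasurable.tsum fun n => (hg n).1.aemeasurable).aestronglyMeasurable, ?_⟩
  calc ∫⁻ c, ‖∑' n, g n c‖ₑ
      ≤ ∫⁻ c, ∑' n, ‖g n c‖ₑ := lintegral_mono fun c => enorm_tsum_le_tsum_enorm
    _ = ∑' n, ∫⁻ c, ‖g n c‖ₑ := lintegral_tsum fun n => (hg n).1.enorm
    _ = ∑' n, ENNReal.ofReal (∫ c, ‖g n c‖) := by
        simp only [ofReal_integral_norm_eq_lintegral_enorm (hg _)]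
    _ = ENNReal.ofReal (∑' n, ∫ c, ‖g n c‖) :=
        (ENNReal.ofReal_tsum_of_nonneg (fun n => integral_nonneg fun c => norm_nonneg _) hsum).symm
    _ < ⊤ := ENNReal.ofReal_lt_top

/-- The change of variables formula, with multiplicities, for functions of one variable without
critical points. -/
theorem exists_integral_eq_setIntegral_mul_deriv {D : Set ℝ} (hD : IsOpen D) {ξ ξ' f : ℝ → ℝ}
    (hξ : ∀ t ∈ D, HasStrictDerivAt ξ (ξ' t) t) (hξ' : ∀ t ∈ D, ξ' t ≠ 0)
    (hf : IntegrableOn (fun t => f t * ξ' t) D) :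
    ∃ G : ℝ → ℝ, Integrable G ∧ ∫ c, G c = ∫ t in D, f t * ξ' t ∧
      ∀ c, ∀ T : Finset ℝ, (∀ t, t ∈ T ↔ t ∈ D ∧ ξ t = c) →
        G c = ∑ t ∈ T, SignType.sign (ξ' t) * f t := by
  classical
  obtain ⟨A, hAm, hAd, hAD, hAi⟩ := exists_measurable_partition_injOn hD hξ hξ'
  have hAsub : ∀ n, A n ⊆ D := fun n => hAD ▸ subset_iUnion A n
  -- Since `|ξ'| * sign ξ' = ξ'`, the Jacobian factor turns `φ` back into `f * ξ'`. The function `g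
  -- n` carries `φ` over to the image of the injective piece `A n`.
  set φ : ℝ → ℝ := fun t => SignType.sign (ξ' t) * f t with hφ
  set g : ℕ → ℝ → ℝ := fun n => (ξ '' A n).indicator (φ ∘ Function.invFunOn ξ (A n)) with hg
  have hder : ∀ n, ∀ t ∈ A n, HasDerivWithinAt ξ (ξ' t) (A n) t := fun n t ht =>
    (hξ t (hAsub n ht)).hasDerivAt.hasDerivWithinAt
  have hinv : ∀ n, ∀ t ∈ A n, Function.invFunOn ξ (A n) (ξ t) = t := fun n t ht =>
    (hAi n).leftInvOn_invFunOn ht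
  have himg : ∀ n, MeasurableSet (ξ '' A n) := fun n =>
    measurable_image_of_fderivWithin (hAm n) (fun t ht => (hder n t ht).hasFDerivWithinAt) (hAi n)
  have hpt : ∀ n, ∀ t ∈ A n,
      |ξ' t| • (φ ∘ Function.invFunOn ξ (A n)) (ξ t) = f t * ξ' t := by
    intro n t ht
    simp only [Function.comp, hinv n t ht, hφ, smul_eq_mul]
    rw [← mul_assoc, mul_comm |ξ' t|, sign_mul_abs, mul_comm]
  have hgi : ∀ n, Integrable (g n) := by
    intro n
    rw [hg, integrable_indicator_iff (himg n),
      integrableOn_image_iff_integrableOn_abs_deriv_smul (hAm n) (hder n) (hAi n)]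
    exact (hf.mono_set (hAsub n)).congr_fun (fun t ht => (hpt n t ht).symm) (hAm n)
  have hint : ∀ n, ∫ c, g n c = ∫ t in A n, f t * ξ' t := by
    intro n
    rw [hg, integral_indicator (himg n),
      integral_image_eq_integral_abs_deriv_smul (hAm n) (hder n) (hAi n)]
    exact setIntegral_congr_fun (hAm n) (hpt n)
  have hnorm : ∀ n, ∫ c, ‖g n c‖ = ∫ t in A n, ‖f t * ξ' t‖ := by
    intro n
    simp only [hg, norm_indicator_eq_indicator_norm]
    rw [integral_indicator (himg n),
      integral_image_eq_integral_abs_deriv_smul (hAm n) (hder n) (hAi n)]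
    refine setIntegral_congr_fun (hAm n) fun t ht => ?_
    simp only [← hpt n t ht, smul_eq_mul, Real.norm_eq_abs, abs_mul, abs_abs]
  have hsum : Summable fun n => ∫ c, ‖g n c‖ := by
    simp only [hnorm]
    exact (hasSum_integral_iUnion hAm hAd (by rw [hAD]; exact hf.norm)).summable
  have h1 := hasSum_integral_of_summable_integral_norm hgi hsum
  simp only [hint] at h1
  have h2 := hasSum_integral_iUnion (f := fun t => f t * ξ' t) hAm hAd (by rwa [hAD])
  rw [hAD] at h2
  refine ⟨fun c => ∑' n, g n c, ?_, h1.unique h2, ?_⟩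
  · exact integrable_tsum_of_summable_integral_norm hgi hsum
  · intro c T hT
    -- The fibre over `c` has at most one point in each `A n`; conversely, each of its points lies
    -- in exactly one piece, which gives `hs`.
    have hgn : ∀ n, g n c = ∑ t ∈ T, (A n).indicator φ t := by
      intro n
      by_cases hc : c ∈ ξ '' A n
      · obtain ⟨t, ht, rfl⟩ := hc
        rw [Finset.sum_eq_single t]
        · simp [hg, ht, hinv n t ht, mem_image_of_mem ξ ht]
        · intro u hu hut
          refine indicator_of_notMem (fun hun => hut ?_) _
          exact hAi n hun ht ((hT u).1 hu).2
        · intro h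
          exact absurd ((hT t).2 ⟨hAsub n ht, rfl⟩) h
      · rw [hg]
        simp only
        rw [indicator_of_notMem hc, Finset.sum_eq_zero]
        intro t ht
        refine indicator_of_notMem (fun htn => hc ⟨t, htn, ((hT t).1 ht).2⟩) _
    have hs : ∀ t ∈ T, HasSum (fun n => (A n).indicator φ t) (φ t) := by
      intro t ht
      have htD := ((hT t).1 ht).1
      rw [← hAD] at htD
      obtain ⟨m, hm⟩ := mem_iUnion.1 htD
      have := hasSum_single (f := fun n => (A n).indicator φ t) m (by
        intro n hn
        exact indicator_of_notMem (fun h => (disjoint_left.1 (hAd hn) h) hm) _)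
      simpa [hm] using this
    have := hasSum_sum hs
    simp only [← hgn] at this
    exact this.tsum_eq

/-- The critical values of a function of one variable form a null set. -/
theorem volume_image_critical_eq_zero {D : Set ℝ} {ξ : ℝ → ℝ}
    (hξ : ∀ t ∈ D, HasDerivAt ξ 0 t) : volume (ξ '' D) = 0 := by
  refine addHaar_image_eq_zero_of_det_fderivWithin_eq_zero volume
    (f' := fun _ => 0) (fun t ht => ?_) (fun t ht => ?_)
  · simpa using (hξ t ht).hasFDerivAt.hasFDerivWithinAt
  · simp

end AreaFormula

/-! ### The two sides of a boundary arc and its orientation sign -/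

/-- Off the frontier, the space is the disjoint union of the open sets `U` and `(closure U)ᶜ`. -/
theorem IsPreconnected.subset_or_disjoint_of_disjoint_frontier {X : Type*} [TopologicalSpace X]
    {P U : Set X} (hP : IsPreconnected P) (hU : IsOpen U) (h : Disjoint P (frontier U)) :
    P ⊆ U ∨ Disjoint P U := by
  by_contra! hcon
  obtain ⟨h1, h2⟩ := hcon
  obtain ⟨x, hxP, hxU⟩ := not_disjoint_iff.1 h2
  have hcov : P ⊆ U ∪ (closure U)ᶜ := fun y hy => by
    by_contra hyU
    simp only [mem_union, mem_compl_iff, not_or, not_not] at hyU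
    exact disjoint_left.1 h hy ⟨hyU.2, by rw [hU.interior_eq]; exact hyU.1⟩
  obtain ⟨y, hyP, hyU⟩ := not_subset.1 h1
  have hyc : y ∈ (closure U)ᶜ := (hcov hyP).resolve_left hyU
  obtain ⟨z, -, hz1, hz2⟩ := hP U _ hU isClosed_closure.isOpen_compl hcov ⟨x, hxP, hxU⟩
    ⟨y, hyP, hyc⟩
  exact hz2 (subset_closure hz1)

theorem HasDerivAt.eventually_pos_nhdsGT {f : ℝ → ℝ} {f' x : ℝ} (h : HasDerivAt f f' x)
    (hx : f x = 0) (hf' : 0 < f') : ∀ᶠ y in 𝓝[>] x, 0 < f y := by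
  have h1 := (h.tendsto_slope.mono_left (nhdsGT_le_nhdsNE x)).eventually (lt_mem_nhds hf')
  filter_upwards [h1, self_mem_nhdsWithin] with y hy hxy
  exact pos_of_slope_pos hxy hy hx

namespace SplitComplex

/-- The determinant of the pair `(v, τ)`. -/
noncomputable def cross (v τ : SplitComplex) : ℝ := v.re * τ.im - v.im * τ.re

/-- The real part, as a continuous linear functional. -/
noncomputable def reL : SplitComplex →L[ℝ] ℝ :=
  LinearMap.toContinuousLinearMap (QuadraticAlgebra.reₗ (1 : ℝ) 0)

/-- The imaginary part, as a continuous linear functional. -/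
noncomputable def imL : SplitComplex →L[ℝ] ℝ :=
  LinearMap.toContinuousLinearMap (QuadraticAlgebra.imₗ (1 : ℝ) 0)

theorem reL_apply (Z : SplitComplex) : reL Z = Z.re := rfl

theorem imL_apply (Z : SplitComplex) : imL Z = Z.im := rfl

theorem continuous_cross_right (v : SplitComplex) : Continuous fun τ => cross v τ := by
  simp only [cross, ← reL_apply, ← imL_apply]
  fun_prop

theorem ne_zero_iff {τ : SplitComplex} : τ ≠ 0 ↔ 0 < τ.re ^ 2 + τ.im ^ 2 := by
  constructor
  · intro h
    by_contra! hle
    refine h (QuadraticAlgebra.ext ?_ ?_)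
    · change τ.re = 0
      nlinarith [sq_nonneg τ.re, sq_nonneg τ.im]
    · change τ.im = 0
      nlinarith [sq_nonneg τ.re, sq_nonneg τ.im]
  · rintro h rfl
    simp at h

/-- The clockwise rotation of a vector by a right angle. -/
def rotate (τ : SplitComplex) : SplitComplex := ⟨τ.im, -τ.re⟩

theorem cross_rotate_pos {τ : SplitComplex} (h : τ ≠ 0) : 0 < cross (rotate τ) τ := by
  have := ne_zero_iff.1 h
  simp only [cross, rotate]
  nlinarith

theorem cross_ne_zero_of_perp {n τ : SplitComplex} (hn : n ≠ 0) (hτ : τ ≠ 0)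
    (h : n.re * τ.re + n.im * τ.im = 0) : cross n τ ≠ 0 := by
  have h1 := mul_pos (ne_zero_iff.1 hn) (ne_zero_iff.1 hτ)
  intro h2
  have : (n.re * τ.re + n.im * τ.im) ^ 2 + cross n τ ^ 2 =
      (n.re ^ 2 + n.im ^ 2) * (τ.re ^ 2 + τ.im ^ 2) := by
    simp only [cross]; ring
  rw [h, h2] at this
  linarith

/-- The linear coordinates of the plane with respect to a frame `τ, ν`. -/
noncomputable def frame (τ ν : SplitComplex) (h : cross ν τ ≠ 0) : (ℝ × ℝ) ≃L[ℝ] SplitComplex :=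
  LinearEquiv.toContinuousLinearEquiv
    { toFun := fun x => x.1 • τ + x.2 • ν
      map_add' := fun x y => by simp only [Prod.fst_add, Prod.snd_add, add_smul]; abel
      map_smul' := fun c x => by
        simp only [Prod.smul_fst, Prod.smul_snd, smul_eq_mul, mul_smul, smul_add, RingHom.id_apply]
      invFun := fun v => (cross ν v / cross ν τ, cross v τ / cross ν τ)
      left_inv := fun x => by
        ext
        · simp only
          rw [div_eq_iff h]
          simp [cross]; ring
        · simp only
          rw [div_eq_iff h]
          simp [cross]; ring
      right_inv := fun v => by
        have h' := h
        simp only [cross] at h'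
        ext
        · simp [cross]; field_simp; ring
        · simp [cross]; field_simp; ring }

theorem frame_apply (τ ν : SplitComplex) (h : cross ν τ ≠ 0) (x : ℝ × ℝ) :
    frame τ ν h x = x.1 • τ + x.2 • ν := rfl

namespace PiecewiseSmoothBoundary

variable {U : Set SplitComplex} (B : PiecewiseSmoothBoundary U)

theorem hasStrictDerivAt_arc (i : Fin B.card) {t : ℝ} (ht : t ∈ Ioo (0 : ℝ) 1) :
    HasStrictDerivAt (B.arc i).extend (velocity (B.arc i) t) t := by
  have hn : I ∈ 𝓝 t := Icc_mem_nhds ht.1 ht.2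
  have h := ((B.smooth i).contDiffAt hn).hasStrictDerivAt (by simp)
  rwa [velocity, derivWithin_of_mem_nhds hn]

theorem continuousOn_velocity (i : Fin B.card) : ContinuousOn (velocity (B.arc i)) I :=
  (B.smooth i).continuousOn_derivWithin (uniqueDiffOn_Icc zero_lt_one) (by simp)

theorem arc_extend_mem_frontier (i : Fin B.card) (t : ℝ) : (B.arc i).extend t ∈ frontier U := by
  rw [← B.iUnion_range]
  refine mem_iUnion.2 ⟨i, ?_⟩
  rw [← Path.extend_range]
  exact ⟨t, rfl⟩

theorem arc_extend_eq {i k : Fin B.card} {s t : ℝ} (hs : s ∈ I) (ht : t ∈ Ioo (0 : ℝ) 1)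
    (h : (B.arc i).extend t = (B.arc k).extend s) : i = k ∧ t = s := by
  have ht' : t ∈ I := Ioo_subset_Icc_self ht
  rw [Path.extend_apply _ ht', Path.extend_apply _ hs] at h
  have := B.simple i k ⟨s, hs⟩ ⟨t, ht'⟩ ht h
  exact ⟨this.1, congrArg Subtype.val this.2⟩

theorem exists_arc_extend_eq {p : SplitComplex} (hp : p ∈ frontier U) :
    ∃ i, ∃ t ∈ I, (B.arc i).extend t = p := by
  rw [← B.iUnion_range] at hp
  obtain ⟨i, t, rfl⟩ := mem_iUnion.1 hp
  exact ⟨i, t, t.2, Path.extend_apply _ t.2⟩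

/-- Close to an interior point of an arc, the boundary consists of that arc only. -/
theorem eventually_frontier_subset (i : Fin B.card) {t₀ : ℝ} (ht₀ : t₀ ∈ Ioo (0 : ℝ) 1) {J : Set ℝ}
    (hJ : IsOpen J) (hJt : t₀ ∈ J) :
    ∀ᶠ p in 𝓝 ((B.arc i).extend t₀), p ∈ frontier U → ∃ t ∈ J, (B.arc i).extend t = p := by
  classical
  -- The compact set of all other arcs together with the part of arc `i` outside `J`; simplicity of
  -- the boundary keeps it away from the given point.
  have hK : IsCompact (⋃ k, (B.arc k).extend '' (if k = i then I \ J else I)) := by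
    refine isCompact_iUnion fun k => IsCompact.image ?_ (B.arc k).continuous_extend
    split_ifs
    · exact isCompact_Icc.diff hJ
    · exact isCompact_Icc
  have hp : (B.arc i).extend t₀ ∈ (⋃ k, (B.arc k).extend '' (if k = i then I \ J else I))ᶜ := by
    intro h
    obtain ⟨k, s, hs, hsk⟩ := mem_iUnion.1 h
    have hsI : s ∈ I := by
      split_ifs at hs
      exacts [hs.1, hs]
    obtain ⟨rfl, rfl⟩ := B.arc_extend_eq hsI ht₀ hsk.symm
    rw [if_pos rfl] at hs
    exact hs.2 hJt
  filter_upwards [hK.isClosed.isOpen_compl.mem_nhds hp] with p hpK hpU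
  obtain ⟨k, s, hs, rfl⟩ := B.exists_arc_extend_eq hpU
  by_cases hk : k = i
  · subst hk
    refine ⟨s, ?_, rfl⟩
    by_contra hsJ
    exact hpK (mem_iUnion.2 ⟨k, s, by rw [if_pos rfl]; exact ⟨hs, hsJ⟩, rfl⟩)
  · exact (hpK (mem_iUnion.2 ⟨k, s, by rwa [if_neg hk], rfl⟩)).elim

/-- Near an interior point, an arc has a positive side `P` and a negative side `N`, each of which
is contained in `U` or disjoint from `U`. -/
theorem exists_sides (hU : IsOpen U) (i : Fin B.card) {t₀ : ℝ} (ht₀ : t₀ ∈ Ioo (0 : ℝ) 1) :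
    ∃ P N : Set SplitComplex, (P ⊆ U ∨ Disjoint P U) ∧ (N ⊆ U ∨ Disjoint N U) ∧
      (P ⊆ U ∨ N ⊆ U) ∧ ∀ᶠ t in 𝓝 t₀, ∀ v,
        (0 < cross v (velocity (B.arc i) t) →
          ∀ᶠ s in 𝓝[>] (0 : ℝ), (B.arc i).extend t + s • v ∈ P) ∧
        (cross v (velocity (B.arc i) t) < 0 →
          ∀ᶠ s in 𝓝[>] (0 : ℝ), (B.arc i).extend t + s • v ∈ N) := by
  set γ := (B.arc i).extend with hγ
  set τ := velocity (B.arc i) with hτ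
  have hτ0 : τ t₀ ≠ 0 := B.regular i t₀ (Ioo_subset_Icc_self ht₀)
  set ν := rotate (τ t₀) with hν
  have hcr : 0 < cross ν (τ t₀) := cross_rotate_pos hτ0
  -- Straightening of the arc: `ν` is a fixed vector transversal to the arc near `t₀`, so `Φ` is a
  -- local diffeomorphism taking the axis `x.2 = 0` to the arc. The sides are the images of the two
  -- half balls.
  set Φ : ℝ × ℝ → SplitComplex := fun x => γ x.1 + x.2 • ν with hΦ
  have hΦ' : ∀ t ∈ Ioo (0 : ℝ) 1, ∀ s, ∀ h : cross ν (τ t) ≠ 0,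
      HasStrictFDerivAt Φ (frame (τ t) ν h : (ℝ × ℝ) →L[ℝ] SplitComplex) (t, s) := by
    intro t ht s h
    have h1 : HasStrictFDerivAt (fun x : ℝ × ℝ => γ x.1) _ (t, s) :=
      HasStrictFDerivAt.comp (t, s) (g := γ)
        (B.hasStrictDerivAt_arc i ht).hasStrictFDerivAt
        (hasStrictFDerivAt_fst (𝕜 := ℝ) (E := ℝ) (F := ℝ))
    have h2 : HasStrictFDerivAt (fun x : ℝ × ℝ => x.2 • ν) _ (t, s) :=
      (hasStrictFDerivAt_snd (𝕜 := ℝ) (E := ℝ) (F := ℝ)).smul_const ν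
    refine (h1.add h2).congr_fderiv ?_
    ext <;> simp [frame_apply, hτ]
  have hstr := hΦ' t₀ ht₀ 0 hcr.ne'
  set e := hstr.toOpenPartialHomeomorph Φ with he
  have heΦ : ∀ x, e x = Φ x := fun x => rfl
  have hsrc : (t₀, (0 : ℝ)) ∈ e.source := hstr.mem_toOpenPartialHomeomorph_source
  have hγc : Continuous γ := (B.arc i).continuous_extend
  have hΦc : Continuous Φ := by fun_prop
  have hΦ0 : ∀ t, Φ (t, 0) = γ t := fun t => by simp [hΦ]
  obtain ⟨δ₁, hδ₁, hball₁⟩ := Metric.isOpen_iff.1 e.open_source _ hsrc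
  have hloc := B.eventually_frontier_subset i ht₀ Metric.isOpen_ball (Metric.mem_ball_self hδ₁)
  rw [← hγ, ← hΦ0] at hloc
  obtain ⟨δ₂, hδ₂, hball₂⟩ := Metric.eventually_nhds_iff_ball.1
    (hΦc.continuousAt.eventually hloc)
  set δ := min δ₁ δ₂ with hδdef
  have hδ : 0 < δ := lt_min hδ₁ hδ₂
  set b := Metric.ball (t₀, (0 : ℝ)) δ with hb
  have hbsrc : b ⊆ e.source := (Metric.ball_subset_ball (min_le_left _ _)).trans hball₁
  have hsep : ∀ x ∈ b, Φ x ∈ frontier U → x.2 = 0 := by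
    intro x hx hxU
    obtain ⟨t, ht, htx⟩ := hball₂ x (Metric.ball_subset_ball (min_le_right _ _) hx) hxU
    have ht1 : (t, (0 : ℝ)) ∈ e.source := hball₁ (by
      rw [Metric.mem_ball, Prod.dist_eq]
      exact max_lt ht (by simpa using hδ₁))
    have := e.injOn ht1 (hbsrc hx) (by rw [heΦ, heΦ, hΦ0]; exact htx)
    rw [← this]
  have hbconv : Convex ℝ b := convex_ball _ _
  have hPc : IsPreconnected (Φ '' (b ∩ {x | 0 < x.2})) :=
    ((hbconv.inter (convex_halfSpace_gt (LinearMap.snd ℝ ℝ ℝ).isLinear 0)).isPreconnected).image _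
      hΦc.continuousOn
  have hNc : IsPreconnected (Φ '' (b ∩ {x | x.2 < 0})) :=
    ((hbconv.inter (convex_halfSpace_lt (LinearMap.snd ℝ ℝ ℝ).isLinear 0)).isPreconnected).image _
      hΦc.continuousOn
  have hPd := hPc.subset_or_disjoint_of_disjoint_frontier hU (by
    rw [disjoint_left]
    rintro _ ⟨x, ⟨hx, hx2⟩, rfl⟩ hxU
    exact (ne_of_gt hx2) (hsep x hx hxU))
  have hNd := hNc.subset_or_disjoint_of_disjoint_frontier hU (by
    rw [disjoint_left]
    rintro _ ⟨x, ⟨hx, hx2⟩, rfl⟩ hxU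
    exact (ne_of_lt hx2) (hsep x hx hxU))
  have hWo : IsOpen (Φ '' b) := e.isOpen_image_of_subset_source Metric.isOpen_ball hbsrc
  refine ⟨_, _, hPd, hNd, ?_, ?_⟩
  -- `U` accumulates at `γ t₀` but misses the arc, being open, so it meets one of the two sides.
  · have hcl : γ t₀ ∈ closure U := frontier_subset_closure (B.arc_extend_mem_frontier i t₀)
    obtain ⟨q, ⟨x, hx, rfl⟩, hqU⟩ := mem_closure_iff.1 hcl _ hWo
      ⟨(t₀, 0), Metric.mem_ball_self hδ, hΦ0 t₀⟩
    rcases lt_trichotomy x.2 0 with h | h | h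
    · refine Or.inr (hNd.resolve_right ?_)
      exact not_disjoint_iff.2 ⟨Φ x, ⟨x, ⟨hx, h⟩, rfl⟩, hqU⟩
    · exfalso
      have : Φ x = γ x.1 := by simp [hΦ, h]
      rw [this] at hqU
      have hfr := B.arc_extend_mem_frontier i x.1
      rw [hU.frontier_eq] at hfr
      exact hfr.2 hqU
    · refine Or.inl (hPd.resolve_right ?_)
      exact not_disjoint_iff.2 ⟨Φ x, ⟨x, ⟨hx, h⟩, rfl⟩, hqU⟩
  · have hτc : ContinuousAt τ t₀ :=
      (B.continuousOn_velocity i).continuousAt (Icc_mem_nhds ht₀.1 ht₀.2)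
    have hcr' : ∀ᶠ t in 𝓝 t₀, 0 < cross ν (τ t) :=
      ((continuous_cross_right ν).continuousAt.comp hτc).eventually (lt_mem_nhds hcr)
    filter_upwards [hcr', Ioo_mem_nhds ht₀.1 ht₀.2, Metric.ball_mem_nhds t₀ hδ] with t hct htI htb v
    have htb' : (t, (0 : ℝ)) ∈ b := by
      rw [hb, Metric.mem_ball, Prod.dist_eq]
      exact max_lt htb (by simpa using hδ)
    have hsymm : e.symm (γ t) = (t, 0) := by
      rw [← hΦ0, ← heΦ]
      exact e.left_inv (hbsrc htb')
    have htgt : γ t ∈ e.target := by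
      rw [← hΦ0, ← heΦ]
      exact e.map_source (hbsrc htb')
    have hinv : HasStrictFDerivAt e.symm _ (γ t) := e.hasStrictFDerivAt_symm htgt (by
      rw [hsymm]
      exact hΦ' t htI 0 hct.ne')
    have hline : HasDerivAt (fun s : ℝ => γ t + s • v) v 0 := by
      simpa using ((hasDerivAt_id (0 : ℝ)).smul_const v).const_add (γ t)
    -- The transversal coordinate vanishes at the start of the ray in direction `v`, and its
    -- derivative there has the sign of `cross v (τ t)`; this decides which side the ray enters.
    have hcomp : HasDerivAt (fun s : ℝ => (e.symm (γ t + s • v)).2)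
        (cross v (τ t) / cross ν (τ t)) 0 := by
      have h1 : HasFDerivAt e.symm
          ((frame (τ t) ν hct.ne').symm : SplitComplex →L[ℝ] ℝ × ℝ) (γ t + (0 : ℝ) • v) := by
        simpa using hinv.hasFDerivAt
      have h2 := h1.comp_hasDerivAt (0 : ℝ) hline
      have h3 := (hasFDerivAt_snd (𝕜 := ℝ) (E := ℝ) (F := ℝ)).comp_hasDerivAt (0 : ℝ) h2
      exact h3
    have hzero : (e.symm (γ t + (0 : ℝ) • v)).2 = 0 := by
      rw [zero_smul, add_zero, hsymm]
    have hin : ∀ᶠ s in 𝓝[>] (0 : ℝ), γ t + s • v ∈ Φ '' b := by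
      refine nhdsWithin_le_nhds (hline.continuousAt.eventually (hWo.mem_nhds ?_))
      exact ⟨(t, 0), htb', by simp [hΦ]⟩
    have hback : ∀ s : ℝ, γ t + s • v ∈ Φ '' b →
        e.symm (γ t + s • v) ∈ b ∧ Φ (e.symm (γ t + s • v)) = γ t + s • v := by
      rintro s ⟨x, hx, hxs⟩
      have : e.symm (γ t + s • v) = x := by
        rw [← hxs, ← heΦ]
        exact e.left_inv (hbsrc hx)
      rw [this]
      exact ⟨hx, hxs⟩
    constructor
    · intro hv
      filter_upwards [hin, hcomp.eventually_pos_nhdsGT hzero (div_pos hv hct)] with s hs hs2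
      exact ⟨_, ⟨(hback s hs).1, hs2⟩, (hback s hs).2⟩
    · intro hv
      have hneg := hcomp.neg.eventually_pos_nhdsGT (by simpa using hzero)
        (neg_pos.2 (div_neg_of_neg_of_pos hv hct))
      filter_upwards [hin, hneg] with s hs hs2
      exact ⟨_, ⟨(hback s hs).1, neg_pos.1 hs2⟩, (hback s hs).2⟩

/-- At the parameter `t`, the region `U` lies to the left of the arc. -/
def LiesLeft (i : Fin B.card) (t : ℝ) : Prop :=
  ∀ v, (0 < cross v (velocity (B.arc i) t) →
      ∀ᶠ s in 𝓝[>] (0 : ℝ), (B.arc i).extend t + s • v ∉ U) ∧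
    (cross v (velocity (B.arc i) t) < 0 →
      ∀ᶠ s in 𝓝[>] (0 : ℝ), (B.arc i).extend t + s • v ∈ U)

/-- At the parameter `t`, the region `U` lies to the right of the arc. -/
def LiesRight (i : Fin B.card) (t : ℝ) : Prop :=
  ∀ v, (0 < cross v (velocity (B.arc i) t) →
      ∀ᶠ s in 𝓝[>] (0 : ℝ), (B.arc i).extend t + s • v ∈ U) ∧
    (cross v (velocity (B.arc i) t) < 0 →
      ∀ᶠ s in 𝓝[>] (0 : ℝ), (B.arc i).extend t + s • v ∉ U)

variable {B}

theorem not_liesLeft_and_liesRight {i : Fin B.card} {t : ℝ} (ht : t ∈ I) (h : B.LiesLeft i t)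
    (h' : B.LiesRight i t) : False := by
  have hpos := cross_rotate_pos (B.regular i t ht)
  obtain ⟨s, hs1, hs2⟩ := (((h _).1 hpos).and ((h' _).1 hpos)).exists
  exact hs1 hs2

theorem exists_outward_extend (i : Fin B.card) {t : ℝ} (ht : t ∈ Ioo (0 : ℝ) 1) :
    ∃ n, IsOutwardNormal U ((B.arc i).extend t) (velocity (B.arc i) t) n := by
  have := B.exists_outward i ⟨t, Ioo_subset_Icc_self ht⟩ ht
  rwa [← Path.extend_apply] at this

/-- The side into which the outward normal points cannot lie in `U`, so it is disjoint from `U` and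
the other side lies in `U`. The same two sides serve all nearby parameters. -/
theorem eventually_liesLeft_or_liesRight (hU : IsOpen U) (i : Fin B.card) {t₀ : ℝ}
    (ht₀ : t₀ ∈ Ioo (0 : ℝ) 1) :
    (∀ᶠ t in 𝓝 t₀, B.LiesLeft i t) ∨ (∀ᶠ t in 𝓝 t₀, B.LiesRight i t) := by
  obtain ⟨P, N, hP, hN, hPN, hev⟩ := B.exists_sides hU i ht₀
  obtain ⟨n, hn⟩ := exists_outward_extend i ht₀
  have hcr := cross_ne_zero_of_perp hn.ne_zero (B.regular i t₀ (Ioo_subset_Icc_self ht₀)) hn.perp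
  rcases lt_or_gt_of_ne hcr with hneg | hpos
  · right
    have hNd : Disjoint N U := by
      refine hN.resolve_left fun hNU => ?_
      obtain ⟨s, hs1, hs2⟩ := (((hev.self_of_nhds n).2 hneg).and hn.outside).exists
      exact hs2 (hNU hs1)
    have hPU : P ⊆ U := by
      refine hPN.resolve_right fun hNU => ?_
      obtain ⟨s, hs⟩ := ((hev.self_of_nhds n).2 hneg).exists
      exact disjoint_left.1 hNd hs (hNU hs)
    filter_upwards [hev] with t ht v
    exact ⟨fun hv => ((ht v).1 hv).mono fun s hs => hPU hs,
      fun hv => ((ht v).2 hv).mono fun s hs => disjoint_left.1 hNd hs⟩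
  · left
    have hPd : Disjoint P U := by
      refine hP.resolve_left fun hPU => ?_
      obtain ⟨s, hs1, hs2⟩ := (((hev.self_of_nhds n).1 hpos).and hn.outside).exists
      exact hs2 (hPU hs1)
    have hNU : N ⊆ U := by
      refine hPN.resolve_left fun hPU => ?_
      obtain ⟨s, hs⟩ := ((hev.self_of_nhds n).1 hpos).exists
      exact disjoint_left.1 hPd hs (hPU hs)
    filter_upwards [hev] with t ht v
    exact ⟨fun hv => ((ht v).1 hv).mono fun s hs => disjoint_left.1 hPd hs,
      fun hv => ((ht v).2 hv).mono fun s hs => hNU hs⟩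

/-- The two alternatives are open and mutually exclusive, and the interval is connected. -/
theorem forall_liesLeft_or_forall_liesRight (hU : IsOpen U) (i : Fin B.card) :
    (∀ t ∈ Ioo (0 : ℝ) 1, B.LiesLeft i t) ∨ (∀ t ∈ Ioo (0 : ℝ) 1, B.LiesRight i t) := by
  by_contra! hcon
  obtain ⟨⟨a, ha, hal⟩, ⟨b, hb, hbr⟩⟩ := hcon
  have hcov : Ioo (0 : ℝ) 1 ⊆ {t | ∀ᶠ u in 𝓝 t, B.LiesLeft i u} ∪
      {t | ∀ᶠ u in 𝓝 t, B.LiesRight i u} := fun t ht => eventually_liesLeft_or_liesRight hU i ht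
  obtain ⟨t, ht, h1, h2⟩ := isPreconnected_Ioo _ _ isOpen_setOfPred_eventually_nhds
    isOpen_setOfPred_eventually_nhds hcov
    ⟨b, hb, (hcov hb).resolve_right fun h => hbr h.self_of_nhds⟩
    ⟨a, ha, (hcov ha).resolve_left fun h => hal h.self_of_nhds⟩
  exact not_liesLeft_and_liesRight (Ioo_subset_Icc_self ht) h1.self_of_nhds h2.self_of_nhds

theorem LiesLeft.isPositiveDirection {i : Fin B.card} {t : ℝ} (ht : t ∈ I)
    (h : B.LiesLeft i t) :
    IsPositiveDirection U ((B.arc i).extend t) (velocity (B.arc i) t) := by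
  have hpos := cross_rotate_pos (B.regular i t ht)
  refine ⟨rotate (velocity (B.arc i) t), ⟨?_, ?_, (h _).1 hpos⟩, hpos⟩
  · intro h0
    rw [h0] at hpos
    simp [cross] at hpos
  · simp [rotate]; ring

theorem LiesRight.not_isPositiveDirection {i : Fin B.card} {t : ℝ} (h : B.LiesRight i t) :
    ¬ IsPositiveDirection U ((B.arc i).extend t) (velocity (B.arc i) t) := by
  rintro ⟨n, hn, hpos⟩
  obtain ⟨s, hs1, hs2⟩ := (((h n).1 hpos).and hn.outside).exists
  exact hs2 hs1

/-- The orientation sign of an arc tells on which side of it the region lies. -/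
theorem orientationSign_spec (hU : IsOpen U) (i : Fin B.card) :
    (B.orientationSign i = 1 ∧ ∀ t ∈ Ioo (0 : ℝ) 1, B.LiesLeft i t) ∨
      (B.orientationSign i = -1 ∧ ∀ t ∈ Ioo (0 : ℝ) 1, B.LiesRight i t) := by
  rcases forall_liesLeft_or_forall_liesRight hU i with h | h
  · refine Or.inl ⟨if_pos fun t ht => ?_, h⟩
    have := (h t ht).isPositiveDirection t.2
    rwa [Path.extend_apply _ t.2] at this
  · refine Or.inr ⟨if_neg fun hpos => ?_, h⟩
    -- The sign defaults to `-1`, so failure at a single interior parameter is enough.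
    have hhalf : (1 / 2 : ℝ) ∈ Ioo (0 : ℝ) 1 := by norm_num
    have := (h _ hhalf).not_isPositiveDirection
    rw [Path.extend_apply _ (Ioo_subset_Icc_self hhalf)] at this
    exact this (hpos ⟨1 / 2, Ioo_subset_Icc_self hhalf⟩ hhalf)

end PiecewiseSmoothBoundary

end SplitComplex

/-! ### Null functionals and null lines -/

theorem Filter.Eventually.comp_sub_nhdsGT {p : ℝ → Prop} (h : ∀ᶠ s in 𝓝[>] (0 : ℝ), p s) (b : ℝ) :
    ∀ᶠ x in 𝓝[>] b, p (x - b) := by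
  refine (tendsto_nhdsWithin_iff.2 ⟨?_, ?_⟩
    : Tendsto (fun x => x - b) (𝓝[>] b) (𝓝[>] 0)).eventually h
  · have : Tendsto (fun x => x - b) (𝓝 b) (𝓝 (b - b)) :=
      (continuous_id.sub continuous_const).tendsto b
    rw [sub_self] at this
    exact this.mono_left nhdsWithin_le_nhds
  · filter_upwards [self_mem_nhdsWithin] with x hx
    exact sub_pos.2 (mem_Ioi.1 hx)

theorem Filter.Eventually.comp_sub_nhdsLT {p : ℝ → Prop} (h : ∀ᶠ s in 𝓝[>] (0 : ℝ), p s) (b : ℝ) :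
    ∀ᶠ x in 𝓝[<] b, p (b - x) := by
  refine (tendsto_nhdsWithin_iff.2 ⟨?_, ?_⟩
    : Tendsto (fun x => b - x) (𝓝[<] b) (𝓝[>] 0)).eventually h
  · have : Tendsto (fun x => b - x) (𝓝 b) (𝓝 (b - b)) :=
      (continuous_const.sub continuous_id).tendsto b
    rw [sub_self] at this
    exact this.mono_left nhdsWithin_le_nhds
  · filter_upwards [self_mem_nhdsWithin] with x hx
    exact sub_pos.2 (mem_Iio.1 hx)

namespace SplitComplex

/-- The null functional `x + j y ↦ x + ε y`, a character of the algebra if `ε ^ 2 = 1`. -/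
noncomputable def nullForm (ε : ℝ) : SplitComplex →L[ℝ] ℝ := reL + ε • imL

/-- A vector in the kernel of `nullForm ε`. -/
def nullVector (ε : ℝ) : SplitComplex := ⟨ε, -1⟩

theorem nullForm_apply (ε : ℝ) (Z : SplitComplex) : nullForm ε Z = Z.re + ε * Z.im := rfl

theorem nullForm_mul {ε : ℝ} (hε : ε * ε = 1) (Z W : SplitComplex) :
    nullForm ε (Z * W) = nullForm ε Z * nullForm ε W := by
  simp only [nullForm_apply, QuadraticAlgebra.re_mul, QuadraticAlgebra.im_mul]
  linear_combination -(Z.im * W.im) * hε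

/-- The link between geometry and analysis: the side of an arc that the null line enters is given by
the sign of the derivative of `nullForm ε` along the arc. -/
theorem cross_nullVector (ε : ℝ) (τ : SplitComplex) : cross (nullVector ε) τ = nullForm ε τ := by
  simp only [cross, nullVector, nullForm_apply]
  ring

theorem cross_neg_left (v τ : SplitComplex) : cross (-v) τ = -cross v τ := by
  simp only [cross, QuadraticAlgebra.re_neg, QuadraticAlgebra.im_neg]
  ring

/-- The point with parameter `s` on the null line `nullForm ε = c`. -/
def nullLine (ε c s : ℝ) : SplitComplex := ⟨c + ε * s, -s⟩

theorem nullForm_nullLine (ε c s : ℝ) : nullForm ε (nullLine ε c s) = c := by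
  simp [nullForm_apply, nullLine]

theorem nullLine_add (ε c s r : ℝ) :
    nullLine ε c (s + r) = nullLine ε c s + r • nullVector ε := by
  ext
  · simp [nullLine, nullVector]; ring
  · simp [nullLine, nullVector]; ring

theorem nullLine_neg_im {ε c : ℝ} {Z : SplitComplex} (h : nullForm ε Z = c) :
    nullLine ε c (-Z.im) = Z := by
  rw [nullForm_apply] at h
  ext
  · simp [nullLine, ← h]
  · simp [nullLine]

theorem continuous_nullLine (ε c : ℝ) : Continuous (nullLine ε c) := by
  have : nullLine ε c = fun s => nullLine ε c 0 + s • nullVector ε := by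
    funext s
    rw [← nullLine_add, zero_add]
  rw [this]
  fun_prop

/-- `a` is locally constant on `V` along the null lines `nullForm ε = c`. -/
def ConstAlongNull (ε : ℝ) (V : Set SplitComplex) (a : SplitComplex → ℝ) : Prop :=
  ∀ Z ∈ V, ∀ᶠ s in 𝓝 (0 : ℝ), a (Z + s • nullVector ε) = a Z

theorem ConstAlongNull.eventually_nullLine {ε c : ℝ} {V : Set SplitComplex} {a : SplitComplex → ℝ}
    (ha : ConstAlongNull ε V a) {x : ℝ} (hx : nullLine ε c x ∈ V) :
    ∀ᶠ y in 𝓝 x, a (nullLine ε c y) = a (nullLine ε c x) := by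
  have h : Tendsto (fun y => y - x) (𝓝 x) (𝓝 0) := by
    exact (continuous_sub_right x).tendsto' x 0 (sub_self x)
  refine (h.eventually (ha _ hx)).mono fun y hy => ?_
  rwa [← nullLine_add, add_sub_cancel] at hy

/-! ### Crossings of null lines with the boundary -/

namespace PiecewiseSmoothBoundary

variable {U : Set SplitComplex} (B : PiecewiseSmoothBoundary U)

/-- `c` is a regular value of `nullForm ε` on all the arcs, and is not attained at end points. -/
def IsRegularValue (ε c : ℝ) : Prop :=
  ∀ i, ∀ t ∈ I, nullForm ε ((B.arc i).extend t) = c →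
    t ∈ Ioo (0 : ℝ) 1 ∧ nullForm ε (velocity (B.arc i) t) ≠ 0

theorem hasStrictDerivAt_nullForm_arc (ε : ℝ) (i : Fin B.card) {t : ℝ} (ht : t ∈ Ioo (0 : ℝ) 1) :
    HasStrictDerivAt (fun t => nullForm ε ((B.arc i).extend t))
      (nullForm ε (velocity (B.arc i) t)) t :=
  (nullForm ε).hasStrictFDerivAt.comp_hasStrictDerivAt t (B.hasStrictDerivAt_arc i ht)

variable {B}

/-- An accumulation point of the level set would be an interior parameter with nonzero derivative,
near which the value `c` is not taken again. -/
theorem IsRegularValue.finite {ε c : ℝ} (hc : B.IsRegularValue ε c) (i : Fin B.card) :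
    {t ∈ I | nullForm ε ((B.arc i).extend t) = c}.Finite := by
  by_contra hinf
  have hsub : {t ∈ I | nullForm ε ((B.arc i).extend t) = c} ⊆ I := fun t ht => ht.1
  have hcont : Continuous fun t => nullForm ε ((B.arc i).extend t) :=
    (nullForm ε).continuous.comp (B.arc i).continuous_extend
  obtain ⟨t, htI, hacc⟩ := Set.Infinite.exists_accPt_of_subset_isCompact hinf isCompact_Icc hsub
  rw [accPt_iff_frequently_nhdsNE] at hacc
  have htc : nullForm ε ((B.arc i).extend t) = c := by
    have hcl : IsClosed {t | nullForm ε ((B.arc i).extend t) = c} :=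
      isClosed_eq hcont continuous_const
    exact hcl.mem_of_frequently_of_tendsto (hacc.mono fun y hy => hy.2)
      (tendsto_id.mono_left nhdsWithin_le_nhds)
  obtain ⟨ht, hne⟩ := hc i t htI htc
  exact hacc ((B.hasStrictDerivAt_nullForm_arc ε i ht).hasDerivAt.eventually_ne (c := c) hne |>.mono
    fun y hy hy' => hy hy'.2)

/-- The point of the arc has parameter `-im` on its null line. The product of signs is `1` where the
line leaves `U` and `-1` where it enters, as seen from the sides met in the directions `± nullVector
ε`. -/
theorem eventually_nullLine_mem {ε c : ℝ} (hU : IsOpen U) {i : Fin B.card} {t : ℝ}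
    (ht : t ∈ Ioo (0 : ℝ) 1) (hne : nullForm ε (velocity (B.arc i) t) ≠ 0)
    (hc : nullForm ε ((B.arc i).extend t) = c) :
    (B.orientationSign i * SignType.sign (nullForm ε (velocity (B.arc i) t)) = 1 ∧
      (∀ᶠ x in 𝓝[<] (-((B.arc i).extend t).im), nullLine ε c x ∈ U) ∧
      (∀ᶠ x in 𝓝[>] (-((B.arc i).extend t).im), nullLine ε c x ∉ U)) ∨
    (B.orientationSign i * SignType.sign (nullForm ε (velocity (B.arc i) t)) = -1 ∧
      (∀ᶠ x in 𝓝[<] (-((B.arc i).extend t).im), nullLine ε c x ∉ U) ∧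
      (∀ᶠ x in 𝓝[>] (-((B.arc i).extend t).im), nullLine ε c x ∈ U)) := by
  set p := (B.arc i).extend t with hp
  set τ := velocity (B.arc i) t with hτ
  have hright : ∀ {S : Set SplitComplex}, (∀ᶠ s in 𝓝[>] (0 : ℝ), p + s • nullVector ε ∈ S) →
      ∀ᶠ x in 𝓝[>] (-p.im), nullLine ε c x ∈ S := by
    intro S h
    refine (h.comp_sub_nhdsGT (-p.im)).mono fun x hx => ?_
    rwa [← nullLine_neg_im hc, ← nullLine_add, nullLine_neg_im hc, add_sub_cancel] at hx
  have hleft : ∀ {S : Set SplitComplex}, (∀ᶠ s in 𝓝[>] (0 : ℝ), p + s • -nullVector ε ∈ S) →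
      ∀ᶠ x in 𝓝[<] (-p.im), nullLine ε c x ∈ S := by
    intro S h
    refine (h.comp_sub_nhdsLT (-p.im)).mono fun x hx => ?_
    rwa [smul_neg, ← neg_smul, neg_sub, ← nullLine_neg_im hc, ← nullLine_add, nullLine_neg_im hc,
      add_sub_cancel] at hx
  have hcr := cross_nullVector ε τ
  have hcr' : cross (-nullVector ε) τ = -nullForm ε τ := by rw [cross_neg_left, hcr]
  rcases orientationSign_spec hU i with ⟨hsign, hside⟩ | ⟨hsign, hside⟩
  · have h1 := hside t ht (nullVector ε)
    have h2 := hside t ht (-nullVector ε)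
    rw [← hτ, ← hp, hcr] at h1
    rw [← hτ, ← hp, hcr'] at h2
    rcases lt_or_gt_of_ne hne with h | h
    · right
      exact ⟨by simp [hsign, sign_neg h], hleft (S := Uᶜ) (h2.1 (by linarith)), hright (h1.2 h)⟩
    · left
      exact ⟨by simp [hsign, sign_pos h], hleft (h2.2 (by linarith)), hright (S := Uᶜ) (h1.1 h)⟩
  · have h1 := hside t ht (nullVector ε)
    have h2 := hside t ht (-nullVector ε)
    rw [← hτ, ← hp, hcr] at h1
    rw [← hτ, ← hp, hcr'] at h2
    rcases lt_or_gt_of_ne hne with h | h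
    · left
      exact ⟨by simp [hsign, sign_neg h], hleft (h2.1 (by linarith)), hright (S := Uᶜ) (h1.2 h)⟩
    · right
      exact ⟨by simp [hsign, sign_pos h], hleft (S := Uᶜ) (h2.2 (by linarith)), hright (h1.1 h)⟩

/-- Along a regular null line, the signed values of `a` at the crossings with the boundary
cancel. -/
theorem IsRegularValue.sum_crossings_eq_zero {ε c : ℝ} (hc : B.IsRegularValue ε c) (hU : IsOpen U)
    (hUb : Bornology.IsBounded U) {V : Set SplitComplex} (hUV : closure U ⊆ V)
    {a : SplitComplex → ℝ} (ha : ConstAlongNull ε V a) (T : Fin B.card → Finset ℝ)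
    (hT : ∀ i t, t ∈ T i ↔ (t ∈ Ioo (0 : ℝ) 1 ∧ nullForm ε (velocity (B.arc i) t) ≠ 0) ∧
      nullForm ε ((B.arc i).extend t) = c) :
    ∑ i, B.orientationSign i * ∑ t ∈ T i,
      SignType.sign (nullForm ε (velocity (B.arc i) t)) * a ((B.arc i).extend t) = 0 := by
  classical
  set pos : (Σ _ : Fin B.card, ℝ) → ℝ := fun q => -((B.arc q.1).extend q.2).im with hpos
  set κ : (Σ _ : Fin B.card, ℝ) → ℝ := fun q =>
    B.orientationSign q.1 * SignType.sign (nullForm ε (velocity (B.arc q.1) q.2)) with hκ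
  set val : (Σ _ : Fin B.card, ℝ) → ℝ := fun q => a ((B.arc q.1).extend q.2) with hval
  have hline : ∀ q ∈ Finset.univ.sigma T, nullLine ε c (pos q) = (B.arc q.1).extend q.2 :=
    fun q hq => nullLine_neg_im ((hT _ _).1 (Finset.mem_sigma.1 hq).2).2
  have hvalV : ∀ q ∈ Finset.univ.sigma T, ∀ᶠ y in 𝓝 (pos q), a (nullLine ε c y) = val q := by
    intro q hq
    have := ha.eventually_nullLine (x := pos q) (c := c) (by
      rw [hline q hq]
      exact hUV (frontier_subset_closure (B.arc_extend_mem_frontier _ _)))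
    rwa [hline q hq] at this
  -- The step function is `a` on `U` and zero elsewhere along the line. At an exit (`κ = 1`) it
  -- drops from `val` to `0`, at an entry (`κ = -1`) it rises from `0` to `val`; in both cases the
  -- jump is `-κ * val`.
  have key := sum_jumps_eq_zero (Finset.univ.sigma T) pos (fun q => (1 + κ q) / 2 * val q)
    (fun q => (1 - κ q) / 2 * val q) ?_
    (fun x => if nullLine ε c x ∈ U then a (nullLine ε c x) else 0) ?_ ?_ ?_ ?_ ?_
  · rw [Finset.sum_sigma] at key
    rw [← neg_eq_zero]
    refine Eq.trans ?_ key
    rw [← Finset.sum_neg_distrib]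
    refine Finset.sum_congr rfl fun i _ => ?_
    rw [Finset.mul_sum, ← Finset.sum_neg_distrib]
    refine Finset.sum_congr rfl fun t _ => ?_
    simp only [hκ, hval]
    ring
  · intro q hq r hr hqr
    have h := hline q hq
    rw [hqr, hline r hr] at h
    have hq' := (hT _ _).1 (Finset.mem_sigma.1 hq).2
    have hr' := (hT _ _).1 (Finset.mem_sigma.1 hr).2
    obtain ⟨h1, h2⟩ := B.arc_extend_eq (Ioo_subset_Icc_self hr'.1.1) hq'.1.1 h.symm
    exact Sigma.ext h1 (heq_of_eq h2)
  · intro q hq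
    have hq' := (hT _ _).1 (Finset.mem_sigma.1 hq).2
    rcases eventually_nullLine_mem hU hq'.1.1 hq'.1.2 hq'.2 with ⟨hk, hl, -⟩ | ⟨hk, hl, -⟩
    · filter_upwards [hl, nhdsWithin_le_nhds (hvalV q hq)] with x hx hx'
      rw [if_pos hx, hx', show κ q = 1 from hk]
      ring
    · filter_upwards [hl] with x hx
      rw [if_neg hx, show κ q = -1 from hk]
      ring
  · intro q hq
    have hq' := (hT _ _).1 (Finset.mem_sigma.1 hq).2
    rcases eventually_nullLine_mem hU hq'.1.1 hq'.1.2 hq'.2 with ⟨hk, -, hr⟩ | ⟨hk, -, hr⟩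
    · filter_upwards [hr] with x hx
      rw [if_neg hx, show κ q = 1 from hk]
      ring
    · filter_upwards [hr, nhdsWithin_le_nhds (hvalV q hq)] with x hx hx'
      rw [if_pos hx, hx', show κ q = -1 from hk]
      ring
  -- Away from the crossings the line is off the frontier: either inside `U`, where `a` is locally
  -- constant, or outside `closure U`.
  · intro x hx
    have hcont := (continuous_nullLine ε c).continuousAt (x := x)
    have hfr : nullLine ε c x ∉ frontier U := by
      intro hmem
      obtain ⟨i, t, ht, hit⟩ := B.exists_arc_extend_eq hmem
      have hval : nullForm ε ((B.arc i).extend t) = c := by rw [hit, nullForm_nullLine]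
      refine hx ⟨i, t⟩ (Finset.mem_sigma.2
        ⟨Finset.mem_univ _, (hT i t).2 ⟨hc i t ht hval, hval⟩⟩) ?_
      simp only [hpos]
      rw [hit]
      simp [nullLine]
    by_cases hxU : nullLine ε c x ∈ U
    · filter_upwards [hcont.eventually (hU.mem_nhds hxU),
        ha.eventually_nullLine (hUV (subset_closure hxU))] with y hy hy'
      rw [if_pos (show nullLine ε c y ∈ U from hy), if_pos hxU, hy']
    · have hxc : nullLine ε c x ∈ (closure U)ᶜ := fun h => hfr (by
        rw [hU.frontier_eq]
        exact ⟨h, hxU⟩)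
      filter_upwards [hcont.eventually (isClosed_closure.isOpen_compl.mem_nhds hxc)] with y hy
      rw [if_neg hxU, if_neg fun h => hy (subset_closure h)]
  · obtain ⟨M, hM⟩ := isBounded_iff_forall_norm_le.1 (imL.lipschitz.isBounded_image hUb)
    filter_upwards [eventually_lt_atBot (-M)] with x hx
    refine if_neg fun h => ?_
    have := hM _ (mem_image_of_mem _ h)
    rw [imL_apply, Real.norm_eq_abs] at this
    simp only [nullLine, abs_neg] at this
    linarith [neg_abs_le x]
  · obtain ⟨M, hM⟩ := isBounded_iff_forall_norm_le.1 (imL.lipschitz.isBounded_image hUb)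
    filter_upwards [eventually_gt_atTop M] with x hx
    refine if_neg fun h => ?_
    have := hM _ (mem_image_of_mem _ h)
    rw [imL_apply, Real.norm_eq_abs] at this
    simp only [nullLine, abs_neg] at this
    linarith [le_abs_self x]

open MeasureTheory in
-- Sard's theorem on each of the finitely many arcs, with the two end point values discarded as
-- well.
theorem ae_isRegularValue (B : PiecewiseSmoothBoundary U) (ε : ℝ) : ∀ᵐ c, B.IsRegularValue ε c := by
  have h : ∀ᵐ c : ℝ, ∀ i : Fin B.card, c ∉ (fun t => nullForm ε ((B.arc i).extend t)) ''
      {t ∈ Ioo (0 : ℝ) 1 | nullForm ε (velocity (B.arc i) t) = 0} ∧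
      c ≠ nullForm ε ((B.arc i).extend 0) ∧ c ≠ nullForm ε ((B.arc i).extend 1) := by
    refine ae_all_iff.2 fun i => ?_
    have h1 : volume ((fun t => nullForm ε ((B.arc i).extend t)) ''
        {t ∈ Ioo (0 : ℝ) 1 | nullForm ε (velocity (B.arc i) t) = 0}) = 0 :=
      volume_image_critical_eq_zero fun t ht => by
        have := (B.hasStrictDerivAt_nullForm_arc ε i ht.1).hasDerivAt
        rwa [ht.2] at this
    filter_upwards [measure_eq_zero_iff_ae_notMem.1 h1,
      Measure.ae_ne volume (nullForm ε ((B.arc i).extend 0)),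
      Measure.ae_ne volume (nullForm ε ((B.arc i).extend 1))] with c h1 h2 h3
    exact ⟨h1, h2, h3⟩
  filter_upwards [h] with c hc i t ht htc
  obtain ⟨h1, h2, h3⟩ := hc i
  have htI : t ∈ Ioo (0 : ℝ) 1 := by
    refine ⟨lt_of_le_of_ne ht.1 ?_, lt_of_le_of_ne ht.2 ?_⟩
    · rintro rfl
      exact h2 htc.symm
    · rintro rfl
      exact h3 htc.symm
  exact ⟨htI, fun h0 => h1 ⟨t, ⟨htI, h0⟩, htc⟩⟩

open MeasureTheory in
theorem sum_integral_nullForm_eq_zero (B : PiecewiseSmoothBoundary U) (ε : ℝ) (hU : IsOpen U)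
    (hUb : Bornology.IsBounded U) {V : Set SplitComplex} (hUV : closure U ⊆ V)
    {a : SplitComplex → ℝ} (ha : ConstAlongNull ε V a) (hac : ContinuousOn a V) :
    ∑ i, B.orientationSign i * ∫ t in (0 : ℝ)..1,
      a ((B.arc i).extend t) * nullForm ε (velocity (B.arc i) t) = 0 := by
  classical
  set D : Fin B.card → Set ℝ := fun i =>
    {t | t ∈ Ioo (0 : ℝ) 1 ∧ nullForm ε (velocity (B.arc i) t) ≠ 0} with hD
  have hvel : ∀ i, ContinuousOn (fun t => nullForm ε (velocity (B.arc i) t)) I := fun i =>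
    (nullForm ε).continuous.comp_continuousOn (B.continuousOn_velocity i)
  have hDo : ∀ i, IsOpen (D i) := fun i =>
    ((hvel i).mono Ioo_subset_Icc_self).isOpen_inter_preimage isOpen_Ioo isOpen_ne
  have hcont : ∀ i, ContinuousOn
      (fun t => a ((B.arc i).extend t) * nullForm ε (velocity (B.arc i) t)) I := fun i =>
    (hac.comp (B.arc i).continuous_extend.continuousOn fun t _ =>
      hUV (frontier_subset_closure (B.arc_extend_mem_frontier i t))).mul (hvel i)
  have hint : ∀ i, IntegrableOn
      (fun t => a ((B.arc i).extend t) * nullForm ε (velocity (B.arc i) t)) I := fun i =>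
    (hcont i).integrableOn_Icc
  have hDI : ∀ i, D i ⊆ I := fun i t ht => Ioo_subset_Icc_self ht.1
  have hG := fun i => exists_integral_eq_setIntegral_mul_deriv (hDo i)
    (fun t ht => B.hasStrictDerivAt_nullForm_arc ε i ht.1) (fun t ht => ht.2)
    ((hint i).mono_set (hDI i))
  choose G hGi hGint hGval using hG
  have hI : ∀ i, ∫ t in (0 : ℝ)..1,
      a ((B.arc i).extend t) * nullForm ε (velocity (B.arc i) t) = ∫ c, G i c := by
    intro i
    rw [hGint, intervalIntegral.integral_of_le zero_le_one, integral_Ioc_eq_integral_Ioo]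
    -- Critical parameters contribute nothing, since the integrand contains the derivative as a
    -- factor.
    refine setIntegral_eq_of_subset_of_forall_sdiff_eq_zero measurableSet_Ioo (fun t ht => ht.1) ?_
    intro t ht
    have : nullForm ε (velocity (B.arc i) t) = 0 := by
      by_contra hne
      exact ht.2 ⟨ht.1, hne⟩
    rw [this, mul_zero]
  simp only [hI, ← integral_const_mul]
  rw [← integral_finsetSum _ fun i _ => (hGi i).const_mul _]
  refine integral_eq_zero_of_ae ?_
  filter_upwards [B.ae_isRegularValue ε] with c hc
  have hfin : ∀ i, {t | t ∈ D i ∧ nullForm ε ((B.arc i).extend t) = c}.Finite := fun i =>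
    (hc.finite i).subset fun t ht => ⟨hDI i ht.1, ht.2⟩
  have hT : ∀ i t, t ∈ (hfin i).toFinset ↔ t ∈ D i ∧ nullForm ε ((B.arc i).extend t) = c :=
    fun i t => by simp
  simp only [fun i => hGval i c _ (hT i)]
  exact hc.sum_crossings_eq_zero hU hUb hUV ha _ hT

end PiecewiseSmoothBoundary

end SplitComplex

/-! ### The equation `∂⁺F = 0` in null coordinates -/

namespace SplitComplex

theorem dZ_apply (τ : SplitComplex) : dZ τ = τ := by
  change τ.re • (1 : SplitComplex) + τ.im • j = τ
  ext <;> simp [j, QuadraticAlgebra.re_one, QuadraticAlgebra.im_one]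

theorem formMulDZ_apply (F : SplitComplex → SplitComplex) (Z τ : SplitComplex) :
    formMulDZ F Z τ = F Z * τ := by
  change F Z * dZ τ = F Z * τ
  rw [dZ_apply]

theorem nullForm_j (ε : ℝ) : nullForm ε j = ε := by
  simp [nullForm_apply, j]

theorem eq_zero_of_nullForm {Z : SplitComplex} (h₁ : nullForm 1 Z = 0) (h₂ : nullForm (-1) Z = 0) :
    Z = 0 := by
  rw [nullForm_apply] at h₁ h₂
  ext
  · rw [QuadraticAlgebra.re_zero]; linarith
  · rw [QuadraticAlgebra.im_zero]; linarith

theorem continuousOn_mul {X : Type*} [TopologicalSpace X] {f g : X → SplitComplex} {s : Set X}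
    (hf : ContinuousOn f s) (hg : ContinuousOn g s) : ContinuousOn (fun x => f x * g x) s := by
  have h : (fun x => f x * g x) = fun x => reL (g x) • f x +
      imL (g x) • LinearMap.toContinuousLinearMap (LinearMap.mulLeft ℝ j) (f x) := by
    funext x
    change f x * g x = (g x).re • f x + (g x).im • (j * f x)
    ext
    · simp [j]; ring
    · simp [j]; ring
  rw [h]
  fun_prop

/-- `∂⁺F = 0` means `F_x = j F_y`, so the derivative along `ε - j` is `(ε j - 1) F_y`. The character
sends `j` to `ε`, hence the factor to `ε ^ 2 - 1 = 0`. -/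
theorem nullForm_fderiv_nullVector {ε : ℝ} (hε : ε * ε = 1) {F : SplitComplex → SplitComplex}
    {Z : SplitComplex} (hF : DifferentiableAt ℝ F Z) (h : dPlus F Z = 0) :
    nullForm ε (fderiv ℝ F Z (nullVector ε)) = 0 := by
  have h1 : fderiv ℝ F Z 1 = j * fderiv ℝ F Z j := by
    rw [dPlus, hF.lineDeriv_eq_fderiv, hF.lineDeriv_eq_fderiv, smul_eq_zero] at h
    exact sub_eq_zero.1 (h.resolve_left (by norm_num))
  have h2 : nullVector ε = ε • (1 : SplitComplex) - j := by
    ext <;> simp [nullVector, j, QuadraticAlgebra.re_one, QuadraticAlgebra.im_one]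
  rw [h2, map_sub, map_sub, map_smul, map_smul, h1, nullForm_mul hε, nullForm_j, smul_eq_mul,
    ← mul_assoc, hε, one_mul, sub_self]

theorem constAlongNull_nullForm_comp {ε : ℝ} (hε : ε * ε = 1) {F : SplitComplex → SplitComplex}
    {V : Set SplitComplex} (hV : IsOpen V) (hF : ∀ Z ∈ V, DifferentiableAt ℝ F Z)
    (hdF : ∀ Z ∈ V, dPlus F Z = 0) : ConstAlongNull ε V fun Z => nullForm ε (F Z) := by
  intro Z hZ
  have hc : Continuous fun s : ℝ => Z + s • nullVector ε := by fun_prop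
  have hnhds : ∀ᶠ s in 𝓝 (0 : ℝ), Z + s • nullVector ε ∈ V :=
    hc.continuousAt.eventually (hV.mem_nhds (by simpa using hZ))
  obtain ⟨δ, hδ, hball⟩ := Metric.eventually_nhds_iff_ball.1 hnhds
  have hder : ∀ s ∈ Metric.ball (0 : ℝ) δ,
      HasDerivAt (fun s : ℝ => nullForm ε (F (Z + s • nullVector ε))) 0 s := by
    intro s hs
    have h1 : HasDerivAt (fun s : ℝ => Z + s • nullVector ε) (nullVector ε) s := by
      simpa using ((hasDerivAt_id s).smul_const (nullVector ε)).const_add Z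
    have h2 := (hF _ (hball s hs)).hasFDerivAt.comp_hasDerivAt s h1
    have h3 := (nullForm ε).hasFDerivAt.comp_hasDerivAt s h2
    rwa [nullForm_fderiv_nullVector hε (hF _ (hball s hs)) (hdF _ (hball s hs))] at h3
  filter_upwards [Metric.ball_mem_nhds (0 : ℝ) hδ] with s hs
  have := Metric.isOpen_ball.is_const_of_deriv_eq_zero (convex_ball (0 : ℝ) δ).isPreconnected
    (fun s hs => (hder s hs).differentiableAt.differentiableWithinAt)
    (fun s hs => (hder s hs).deriv) hs (Metric.mem_ball_self hδ)
  simpa using this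

theorem PiecewiseSmoothBoundary.nullForm_curveIntegral {U : Set SplitComplex}
    (B : PiecewiseSmoothBoundary U) {V : Set SplitComplex} (hUV : closure U ⊆ V)
    {F : SplitComplex → SplitComplex} (hF : ContinuousOn F V) {ε : ℝ} (hε : ε * ε = 1)
    (i : Fin B.card) :
    nullForm ε (curveIntegral (formMulDZ F) (B.arc i)) = ∫ t in (0 : ℝ)..1,
      nullForm ε (F ((B.arc i).extend t)) * nullForm ε (velocity (B.arc i) t) := by
  have hfun : curveIntegralFun (formMulDZ F) (B.arc i) =
      fun t => F ((B.arc i).extend t) * velocity (B.arc i) t := by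
    funext t
    rw [curveIntegralFun_def, formMulDZ_apply]
    rfl
  have hcont : ContinuousOn (fun t => F ((B.arc i).extend t) * velocity (B.arc i) t) I :=
    continuousOn_mul (hF.comp (B.arc i).continuous_extend.continuousOn fun t _ =>
      hUV (frontier_subset_closure (B.arc_extend_mem_frontier i t))) (B.continuousOn_velocity i)
  rw [curveIntegral_def, hfun, ← ContinuousLinearMap.intervalIntegral_comp_comm]
  · simp only [nullForm_mul hε]
  · refine ContinuousOn.intervalIntegrable ?_
    rwa [uIcc_of_le zero_le_one]

end SplitComplex

open SplitComplex in
theorem nullForm_boundaryIntegral_eq_zero {U : Set SplitComplex} (hU : IsOpen U)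
    (hUb : Bornology.IsBounded U) (B : PiecewiseSmoothBoundary U) {V : Set SplitComplex}
    (hV : IsOpen V) (hUV : closure U ⊆ V) {F : SplitComplex → SplitComplex}
    (hF : ContDiffOn ℝ ∞ F V) (hdF : ∀ Z ∈ V, dPlus F Z = 0) {ε : ℝ} (hε : ε * ε = 1) :
    nullForm ε (B.boundaryIntegral F) = 0 := by
  have hdiff : ∀ Z ∈ V, DifferentiableAt ℝ F Z := fun Z hZ =>
    (hF.contDiffAt (hV.mem_nhds hZ)).differentiableAt (by simp)
  rw [PiecewiseSmoothBoundary.boundaryIntegral, map_sum]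
  simp only [map_smul, smul_eq_mul, B.nullForm_curveIntegral hUV hF.continuousOn hε]
  exact B.sum_integral_nullForm_eq_zero ε hU hUb hUV (constAlongNull_nullForm_comp hε hV hdiff hdF)
    ((nullForm ε).continuous.comp_continuousOn hF.continuousOn)

theorem mainTheorem4 (U : Set SplitComplex) (hU : IsOpen U) (hUb : Bornology.IsBounded U)
    (B : SplitComplex.PiecewiseSmoothBoundary U)
    (V : Set SplitComplex) (hV : IsOpen V) (hUV : closure U ⊆ V)
    (F : SplitComplex → SplitComplex) (hF : ContDiffOn ℝ ∞ F V)
    (hdF : ∀ Z ∈ V, SplitComplex.dPlus F Z = 0) :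
    B.boundaryIntegral F = 0 := by
  -- The two characters `ε = 1` and `ε = -1` determine the value of the integral.
  exact SplitComplex.eq_zero_of_nullForm
    (nullForm_boundaryIntegral_eq_zero hU hUb B hV hUV hF hdF (by norm_num))
    (nullForm_boundaryIntegral_eq_zero hU hUb B hV hUV hF hdF (by norm_num))
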